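/- All graphs are finite and simple. An interval $t$-coloring of a graph $G$ is an edge-coloring of $G$ with colors $1,\ldots,t$ such that all colors are used and, at each vertex, the colors of the incident edges are distinct and form an interval of integers. $G$ is interval colorable if it has an interval $t$-coloring for some positive integer $t$, and then $W(G)$ denotes the greatest such $t$. Let $K_m$ be the complete graph on $m$ vertices, $C_m$ the cycle on $m$ vertices, and $\square$ the Cartesian product of graphs. Let $n\ge 2$ be an integer with $n=p\,2^{q}$, where $p$ is odd and $q\ge 0$ is an integer. Then $K_{2n}\square C_{2n}$ is interval colorable and $$W(K_{2n}\square C_{2n})\ \ge\ 2n^{2}+4n-1-p-q.$$ -/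

import Mathlib

/-- `α` is an interval `t`-coloring of `G`. Only the values of `α` on edges of `G` matter:
they lie in `{1, …, t}`, every color of `{1, …, t}` is used, and at each vertex the colors of the
incident edges are pairwise distinct and form an interval of integers (the empty interval at an
isolated vertex). -/
structure SimpleGraph.IsIntervalColoring {V : Type*} (G : SimpleGraph V) (t : ℕ)
    (α : Sym2 V → ℕ) : Prop where
  mem_Icc : ∀ e ∈ G.edgeSet, α e ∈ Set.Icc 1 t
  all_used : ∀ c ∈ Set.Icc 1 t, ∃ e ∈ G.edgeSet, α e = c
  injOn : ∀ v : V, Set.InjOn α (G.incidenceSet v)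
  interval : ∀ v : V, ∃ a b : ℕ, α '' G.incidenceSet v = Set.Icc a b

/-- The positive integers `t` for which `G` has an interval `t`-coloring. -/
def SimpleGraph.intervalSpectrum {V : Type*} (G : SimpleGraph V) : Set ℕ :=
  {t | 0 < t ∧ ∃ α : Sym2 V → ℕ, G.IsIntervalColoring t α}

/-- `G` is interval colorable: it has an interval `t`-coloring for some positive integer `t`. -/
def SimpleGraph.IntervalColorable {V : Type*} (G : SimpleGraph V) : Prop :=
  G.intervalSpectrum.Nonempty

/-- `W(G)`: the greatest `t` for which `G` has an interval `t`-coloring. For finite interval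
colorable `G` it is a maximum, see `SimpleGraph.isGreatest_maxIntervalColors`. -/
noncomputable def SimpleGraph.maxIntervalColors {V : Type*} (G : SimpleGraph V) : ℕ :=
  sSup G.intervalSpectrum

theorem SimpleGraph.isGreatest_maxIntervalColors {V : Type*} [Finite V] (G : SimpleGraph V)
    (hG : G.IntervalColorable) : IsGreatest G.intervalSpectrum G.maxIntervalColors := by
  have hb : BddAbove G.intervalSpectrum := by
    refine ⟨G.edgeSet.ncard, ?_⟩
    rintro t ⟨-, α, hα⟩
    have hsub : Set.Icc 1 t ⊆ α '' G.edgeSet := fun c hc => hα.all_used c hc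
    have h1 := Set.ncard_le_ncard hsub (Set.toFinite _)
    have h2 := Set.ncard_image_le (f := α) (Set.toFinite G.edgeSet)
    have h3 : (Set.Icc 1 t).ncard = t := by
      rw [Set.ncard_eq_toFinset_card']; simp
    omega
  exact ⟨Nat.sSup_mem hG hb, fun t ht => le_csSup hb ht⟩

/-!
The lower bound comes from an explicit coloring. In an interval coloring of an `r`-regular graph the
colors at a vertex `v` form a window `l v, …, l v + r - 1`, and by counting it is enough that they
are distinct and lie in the window. Moreover, in a connected graph all colors between the smallest
and the largest one are used (`SimpleGraph.IsIntervalLabeling.exists_adj_eq`).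

* `K_{2p}` has an interval coloring with `3p - 2` colors
  (`SimpleGraph.isIntervalLabeling_completeBaseLabel`).
* An interval coloring of `K_m` with `t` colors gives one of `K_{2m}` with `t + 2m - 1` colors
  (`SimpleGraph.IsIntervalLabeling.double`). For `m = 2k` and `k = p * 2 ^ i`, summing over the `q`
  doublings that lead from `K_{2p}` to `K_{2n}` gives `4n - 2 - p - q` colors.
* An interval coloring of an `r`-regular graph `G` with `t` colors gives one of `G □ C_{2n}` with
  `t + n (r + 1) + 1` colors (`SimpleGraph.IsIntervalLabeling.boxCycle`). The layers of `G` at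
  distance `k` from a base vertex of the cycle are shifted by `k (r + 1)`, which leaves exactly one
  free color between the windows of `G` in consecutive layers for the link. The layers and links of
  the second half of the cycle, and the layer at the antipode, are then raised by one color, which
  makes the two links at the base, and those at the antipode, consecutive.

With `r = 2n - 1` the total is `(4n - 2 - p - q) + 2n² + 1`.
-/

namespace SimpleGraph

variable {V W : Type*}

/-! ### Interval labelings of regular graphs -/

/-- An interval `t`-coloring of an `r`-regular graph `G`, given as a symmetric function `c` on pairs
of vertices together with a function `l`: the colors at `v` are distinct and lie in
`{l v, …, l v + r - 1}`, hence fill it once `v` has degree `r`. In place of all colors being used,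
only the two extreme windows are required to occur; for connected `G` the rest follows. -/
structure IsIntervalLabeling (G : SimpleGraph V) (r t : ℕ) (c : V → V → ℕ) (l : V → ℕ) :
    Prop where
  symm : ∀ v w, c v w = c w v
  injOn : ∀ v, Set.InjOn (c v) (G.neighborSet v)
  mem_Ico : ∀ v w, G.Adj v w → c v w ∈ Set.Ico (l v) (l v + r)
  one_le : ∀ v, 1 ≤ l v
  le : ∀ v, l v + r ≤ t + 1
  exists_min : ∃ v, l v = 1
  exists_max : ∃ v, l v + r = t + 1

namespace IsIntervalLabeling

variable {G : SimpleGraph V} {r t : ℕ} {c : V → V → ℕ} {l : V → ℕ}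

theorem image_neighborSet [G.LocallyFinite] (h : G.IsIntervalLabeling r t c l)
    (hG : G.IsRegularOfDegree r) (v : V) : c v '' G.neighborSet v = Set.Ico (l v) (l v + r) := by
  refine Set.eq_of_subset_of_ncard_le ?_ ?_ (Set.finite_Ico _ _)
  · rintro _ ⟨w, hw, rfl⟩
    exact h.mem_Ico v w hw
  · rw [(h.injOn v).ncard_image, Set.ncard_eq_toFinset_card', Set.ncard_eq_toFinset_card',
      ← SimpleGraph.neighborFinset, card_neighborFinset_eq_degree, hG v]
    simp

/-- If a color `k` is missing, then every vertex sees only colors below `k` or only colors above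
`k`; adjacent vertices share an edge, so one alternative holds throughout the graph, which
contradicts the presence of both extreme windows. -/
theorem exists_adj_eq [G.LocallyFinite] (h : G.IsIntervalLabeling r t c l)
    (hG : G.IsRegularOfDegree r) (hconn : G.Preconnected) {k : ℕ}
    (hk : k ∈ Set.Icc 1 t) : ∃ v w, G.Adj v w ∧ c v w = k := by
  by_contra! hne
  have side : ∀ v, k < l v ∨ l v + r ≤ k := by
    intro v
    by_contra! hv
    have : k ∈ c v '' G.neighborSet v := by
      rw [h.image_neighborSet hG]
      exact hv
    obtain ⟨w, hw, hw'⟩ := this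
    exact hne v w hw hw'
  have key : ∀ v w, G.Reachable v w → l v + r ≤ k → l w + r ≤ k := by
    rintro v w ⟨p⟩
    induction p with
    | nil => exact id
    | cons hadj _ ih =>
      intro hv
      apply ih
      have h1 := h.mem_Ico _ _ hadj
      have h2 := h.mem_Ico _ _ hadj.symm
      rw [h.symm] at h2
      have h3 := side ‹_›
      simp only [Set.mem_Ico] at h1 h2
      grind
  obtain ⟨v, hv⟩ := h.exists_min
  obtain ⟨w, hw⟩ := h.exists_max
  obtain ⟨hk1, hk2⟩ := hk
  have h1 := side v
  have h2 := key v w (hconn v w) (by omega)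
  omega

theorem isIntervalColoring [G.LocallyFinite] (h : G.IsIntervalLabeling r t c l)
    (hG : G.IsRegularOfDegree r) (hr : 1 ≤ r) (hconn : G.Preconnected) :
    G.IsIntervalColoring t (Sym2.lift ⟨c, h.symm⟩) where
  mem_Icc e he := by
    induction e with
    | _ v w =>
      have h1 := h.mem_Ico v w he
      have h2 := h.one_le v
      have h3 := h.le v
      simp only [Set.mem_Ico] at h1
      simp only [Sym2.lift_mk, Set.mem_Icc]
      omega
  all_used k hk := by
    obtain ⟨v, w, hvw, hc⟩ := h.exists_adj_eq hG hconn hk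
    exact ⟨s(v, w), hvw, by simpa using hc⟩
  injOn v := by
    rintro e ⟨he, hve⟩ f ⟨hf, hvf⟩ hef
    obtain ⟨w, rfl⟩ := hve
    obtain ⟨x, rfl⟩ := hvf
    exact congrArg (fun y => s(v, y)) (h.injOn v he hf hef)
  interval v := by
    refine ⟨l v, l v + r - 1, ?_⟩
    have : Set.Icc (l v) (l v + r - 1) = Set.Ico (l v) (l v + r) := by
      ext k
      simp only [Set.mem_Icc, Set.mem_Ico]
      omega
    rw [this, ← h.image_neighborSet hG]
    ext k
    constructor
    · rintro ⟨e, ⟨he, hve⟩, rfl⟩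
      obtain ⟨w, rfl⟩ := hve
      exact ⟨w, he, rfl⟩
    · rintro ⟨w, hw, rfl⟩
      exact ⟨s(v, w), (G.mk'_mem_incidenceSet_left_iff).2 hw, rfl⟩

theorem comap {H : SimpleGraph W} (h : G.IsIntervalLabeling r t c l) (e : H ≃g G) :
    H.IsIntervalLabeling r t (fun v w => c (e v) (e w)) (fun v => l (e v)) where
  symm _ _ := h.symm _ _
  injOn _ _ hw _ hx hwx :=
    e.injective (h.injOn _ (e.map_adj_iff.2 hw) (e.map_adj_iff.2 hx) hwx)
  mem_Ico _ _ hvw := h.mem_Ico _ _ (e.map_adj_iff.2 hvw)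
  one_le _ := h.one_le _
  le _ := h.le _
  exists_min := by
    obtain ⟨v, hv⟩ := h.exists_min
    exact ⟨e.symm v, by simpa using hv⟩
  exists_max := by
    obtain ⟨v, hv⟩ := h.exists_max
    exact ⟨e.symm v, by simpa using hv⟩

end IsIntervalLabeling

/-! ### Complete graphs -/

/-- Edge labels of a coloring of `K_{2p}` with `3p - 2` colors. The two copies of `K_p` and the
matching between corresponding vertices form `K_p □ K_2`, which `p + (i + j) % p` colors properly
with the `p` colors `p, …, 2p - 1`; each color `p - d` or `2p - 1 + d` off this range lies on
cross edges between indices that differ by `d`. -/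
def completeBaseLabel (p : ℕ) (v w : Fin p × Bool) : ℕ :=
  if v.2 = w.2 ∨ v.1 = w.1 then p + (v.1 + w.1 : ℕ) % p
  else
    let i : ℕ := if v.2 then w.1 else v.1
    let j : ℕ := if v.2 then v.1 else w.1
    if i < j then p + i - j else 2 * p - 1 + i - j

theorem isIntervalLabeling_completeBaseLabel {p : ℕ} (hp : 1 ≤ p) :
    (⊤ : SimpleGraph (Fin p × Bool)).IsIntervalLabeling (2 * p - 1) (3 * p - 2)
      (completeBaseLabel p) (fun v => if v.2 then p - v.1 else v.1 + 1) where
  symm := by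
    rintro ⟨i, a⟩ ⟨j, b⟩
    have := Nat.add_comm (i : ℕ) j
    cases a <;> cases b <;> simp [completeBaseLabel, this, eq_comm]
  injOn := by
    -- The residue `(i + j) % p` determines `j < p`.
    have cancel : ∀ i j k : Fin p, (i + j : ℕ) % p = (i + k : ℕ) % p → j = k := by
      intro i j k h
      have h' : (j : ℕ) ≡ k [MOD p] := Nat.ModEq.add_left_cancel' (i : ℕ) h
      exact Fin.ext (Nat.ModEq.eq_of_lt_of_lt h' j.2 k.2)
    rintro ⟨i, a⟩ ⟨j, b⟩ hj ⟨k, d⟩ hk h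
    have h1 := Nat.mod_lt (i + j : ℕ) hp
    have h2 := Nat.mod_lt (i + k : ℕ) hp
    have h3 := cancel i j k
    have := i.2
    have := j.2
    have := k.2
    simp only [mem_neighborSet, top_adj, ne_eq, Prod.mk.injEq, Fin.ext_iff] at hj hk h3 ⊢
    cases a <;> cases b <;> cases d <;> simp [completeBaseLabel, Fin.ext_iff] at h hj hk ⊢ <;>
      grind
  mem_Ico := by
    rintro ⟨i, a⟩ ⟨j, b⟩ hj
    have h1 := Nat.mod_lt (i + j : ℕ) hp
    have := i.2
    have := j.2
    simp only [top_adj, ne_eq, Prod.mk.injEq, Fin.ext_iff] at hj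
    cases a <;> cases b <;> simp [completeBaseLabel, Fin.ext_iff] at hj ⊢ <;> grind
  one_le := by
    rintro ⟨i, a⟩
    have := i.2
    cases a <;> simp
    omega
  le := by
    rintro ⟨i, a⟩
    have := i.2
    cases a <;> simp <;> omega
  exists_min := ⟨(⟨0, hp⟩, false), by simp⟩
  exists_max := ⟨(⟨0, hp⟩, true), by simp; omega⟩

/-- Edge labels for the doubled complete graph: the second copy carries the colors of the first
one shifted by `2r + 1`, a cross edge between `v` and `w` repeats the color of `vw` shifted by
`r`, and the edge joining the two copies of `v` receives the one color that is left at both. -/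
def doubleLabel [DecidableEq V] (r : ℕ) (c : V → V → ℕ) (l : V → ℕ) (v w : V × Bool) : ℕ :=
  if v.1 = w.1 then l v.1 + 2 * r
  else c v.1 w.1 + if v.2 = w.2 then (if v.2 then 2 * r + 1 else 0) else r

theorem IsIntervalLabeling.double [DecidableEq V] {r t : ℕ} {c : V → V → ℕ} {l : V → ℕ}
    (h : (⊤ : SimpleGraph V).IsIntervalLabeling r t c l) :
    (⊤ : SimpleGraph (V × Bool)).IsIntervalLabeling (2 * r + 1) (t + (2 * r + 1))
      (doubleLabel r c l) (fun v => if v.2 then l v.1 + r else l v.1) where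
  symm := by
    rintro ⟨v, a⟩ ⟨w, b⟩
    have := h.symm v w
    by_cases hvw : v = w
    · subst hvw
      simp [doubleLabel]
    · cases a <;> cases b <;> simp [doubleLabel, this, hvw, Ne.symm hvw]
  injOn := by
    rintro ⟨v, a⟩ ⟨w, b⟩ hw ⟨x, d⟩ hx hwx
    have h1 := h.mem_Ico v w
    have h2 := h.mem_Ico v x
    have h3 : w ∈ _ → x ∈ _ → c v w = c v x → w = x := fun hw hx => h.injOn v hw hx
    simp only [mem_neighborSet, top_adj, ne_eq, Prod.mk.injEq, Set.mem_Ico] at hw hx h1 h2 h3 ⊢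
    cases a <;> cases b <;> cases d <;> simp [doubleLabel] at hw hx hwx ⊢ <;> grind
  mem_Ico := by
    rintro ⟨v, a⟩ ⟨w, b⟩ hw
    have h1 := h.mem_Ico v w
    simp only [top_adj, ne_eq, Prod.mk.injEq, Set.mem_Ico] at hw h1 ⊢
    cases a <;> cases b <;> simp [doubleLabel] at hw ⊢ <;> grind
  one_le := by
    rintro ⟨v, a⟩
    have := h.one_le v
    cases a <;> simp <;> omega
  le := by
    rintro ⟨v, a⟩
    have := h.le v
    cases a <;> simp <;> omega
  exists_min := by
    obtain ⟨v, hv⟩ := h.exists_min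
    exact ⟨(v, false), by simpa using hv⟩
  exists_max := by
    obtain ⟨v, hv⟩ := h.exists_max
    exact ⟨(v, true), by simp; omega⟩

theorem IsIntervalLabeling.exists_of_card_eq {r t : ℕ} {c : V → V → ℕ} {l : V → ℕ} [Fintype V]
    (h : (⊤ : SimpleGraph V).IsIntervalLabeling r t c l) {m : ℕ} (hm : Fintype.card V = m) :
    ∃ c' l', (⊤ : SimpleGraph (Fin m)).IsIntervalLabeling r t c' l' :=
  ⟨_, _, h.comap (Iso.completeGraph (Fintype.equivFinOfCardEq hm).symm)⟩

/-- `W(K_{2n}) ≥ 4n - 2 - p - q` for `n = p * 2 ^ q`, written without subtraction: the base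
labeling has `3p - 2` colors, and the `q` doublings add `2m - 1` colors each to `K_m`. -/
theorem exists_isIntervalLabeling_complete {p : ℕ} (hp : 1 ≤ p) (q : ℕ) :
    ∃ t c l, t + p + q + 2 = 4 * (p * 2 ^ q) ∧
      (⊤ : SimpleGraph (Fin (2 * (p * 2 ^ q)))).IsIntervalLabeling
        (2 * (p * 2 ^ q) - 1) t c l := by
  induction q with
  | zero =>
    obtain ⟨c, l, h⟩ := (isIntervalLabeling_completeBaseLabel hp).exists_of_card_eq
      (m := 2 * (p * 2 ^ 0)) (by simp [mul_comm])
    exact ⟨3 * p - 2, c, l, by simp; omega, by simpa using h⟩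
  | succ q ih =>
    obtain ⟨t, c, l, ht, h⟩ := ih
    have hpos : 1 ≤ p * 2 ^ q := Nat.mul_pos hp (by positivity)
    have hpow : p * 2 ^ (q + 1) = 2 * (p * 2 ^ q) := by ring
    obtain ⟨c', l', h'⟩ := h.double.exists_of_card_eq
      (m := 2 * (p * 2 ^ (q + 1))) (by simp [hpow, mul_comm])
    have hdeg : 2 * (p * 2 ^ (q + 1)) - 1 = 2 * (2 * (p * 2 ^ q) - 1) + 1 := by omega
    refine ⟨_, c', l', ?_, hdeg ▸ h'⟩
    omega

/-! ### Products with an even cycle -/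

/-- The distance of the vertex `x` of the cycle `0, 1, …, 2n - 1` from the vertex `0`. -/
def cycleLevel (n x : ℕ) : ℕ := min x (2 * n - x)

/-- The shift of the coloring of `G` in layer `x`; the second half of the cycle is one color
ahead. -/
def layerShift (n r x : ℕ) : ℕ := cycleLevel n x * (r + 1) + if n ≤ x then 1 else 0

/-- The color, relative to the lower end of the window of `G` at `v`, of the edge that joins
`(v, x)` to `(v, y)`. -/
def linkShift (n r x y : ℕ) : ℕ :=
  min (cycleLevel n x) (cycleLevel n y) * (r + 1) + r + if n < max x y then 1 else 0

/-- The lower end of the window at layer `x`, relative to that of `G`. Every layer but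
`x = 0` has a link one color below its shifted copy of `G`; at `x = 0` the subtraction truncates to
`0`. -/
def windowShift (n r x : ℕ) : ℕ := cycleLevel n x * (r + 1) + (if n < x then 1 else 0) - 1

theorem linkShift_comm (n r x y : ℕ) : linkShift n r x y = linkShift n r y x := by
  simp only [linkShift, min_comm, max_comm]

theorem val_of_cycleGraph_adj {m : ℕ} {x y : Fin m} (h : (cycleGraph m).Adj x y) :
    (y : ℕ) = x + 1 ∨ (x : ℕ) = y + 1 ∨ ((x : ℕ) = 0 ∧ (y : ℕ) + 1 = m) ∨
      ((y : ℕ) = 0 ∧ (x : ℕ) + 1 = m) := by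
  have := x.2
  have := y.2
  have hne := h.ne
  rw [cycleGraph_adj'] at h
  rcases hne.lt_or_gt with hxy | hxy
  · rw [Fin.coe_sub_iff_lt.2 hxy, Fin.coe_sub_iff_le.2 hxy.le] at h
    rw [Fin.lt_def] at hxy
    omega
  · rw [Fin.coe_sub_iff_lt.2 hxy, Fin.coe_sub_iff_le.2 hxy.le] at h
    rw [Fin.lt_def] at hxy
    omega

theorem cycleGraph_degree_eq_two {m : ℕ} (hm : 3 ≤ m) (x : Fin m) :
    (cycleGraph m).degree x = 2 := by
  obtain ⟨k, rfl⟩ := Nat.exists_eq_add_of_le' hm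
  exact cycleGraph_degree_three_le

/-- An edge of the cycle joins consecutive levels, which expresses its link color through the level
of either endpoint. -/
theorem linkShift_cases {n r : ℕ} {x y : Fin (2 * n)} (h : (cycleGraph (2 * n)).Adj x y) :
    (cycleLevel n y = cycleLevel n x + 1 ∧ linkShift n r x y =
      cycleLevel n x * (r + 1) + r + if n < max (x : ℕ) y then 1 else 0) ∨
    (cycleLevel n x = cycleLevel n y + 1 ∧ linkShift n r x y + 1 =
      cycleLevel n x * (r + 1) + if n < max (x : ℕ) y then 1 else 0) := by
  have hlev : cycleLevel n y = cycleLevel n x + 1 ∨ cycleLevel n x = cycleLevel n y + 1 := by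
    have := val_of_cycleGraph_adj h
    simp only [cycleLevel]
    omega
  rcases hlev with hlev | hlev
  · left
    simp [linkShift, hlev]
  · right
    refine ⟨hlev, ?_⟩
    simp only [linkShift, hlev, min_eq_right (Nat.le_succ _)]
    ring

theorem level_mul_pos {n r x : ℕ} (hx : x ≠ 0) (hxn : x < 2 * n) :
    r + 1 ≤ cycleLevel n x * (r + 1) :=
  Nat.le_mul_of_pos_left _ (by simp only [cycleLevel]; omega)

theorem linkShift_injOn {n r : ℕ} (x : Fin (2 * n)) :
    Set.InjOn (fun y : Fin (2 * n) => linkShift n r x y) ((cycleGraph (2 * n)).neighborSet x) := by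
  intro y hy z hz h
  have h1 := linkShift_cases (r := r) hy
  have h2 := linkShift_cases (r := r) hz
  have h3 := val_of_cycleGraph_adj hy
  have h4 := val_of_cycleGraph_adj hz
  have := x.2
  simp only at h
  rw [Fin.ext_iff]
  generalize cycleLevel n x * (r + 1) = P at h1 h2
  simp only [cycleLevel] at h1 h2
  grind

/-- The window at a layer has `r + 2` colors: those of `G`, and two link colors outside them. -/
theorem linkShift_mem {n r : ℕ} {x y : Fin (2 * n)} (h : (cycleGraph (2 * n)).Adj x y) :
    windowShift n r x ≤ linkShift n r x y ∧ linkShift n r x y < windowShift n r x + (r + 2) ∧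
      (linkShift n r x y < layerShift n r x ∨ layerShift n r x + r ≤ linkShift n r x y) := by
  have h1 := linkShift_cases (r := r) h
  have h3 := val_of_cycleGraph_adj h
  have h5 := x.2
  have h6 := level_mul_pos (r := r) (n := n) (x := x)
  have h0 : (x : ℕ) = 0 → cycleLevel n x * (r + 1) = 0 := by
    intro hx
    simp [cycleLevel, hx]
  simp only [windowShift, layerShift]
  generalize cycleLevel n x * (r + 1) = P at h1 h6 h0 ⊢
  simp only [cycleLevel] at h1
  grind

theorem layerShift_mem (n r x : ℕ) :
    windowShift n r x ≤ layerShift n r x ∧ layerShift n r x ≤ windowShift n r x + 2 := by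
  simp only [windowShift, layerShift]
  grind

/-- Edge labels of `G □ C_{2n}`: the coloring of `G` in each layer, shifted by `layerShift`, and
the link colors between the layers. The value on pairs that agree in no coordinate is `0` so that
the function is symmetric. -/
def boxCycleLabel [DecidableEq V] (n r : ℕ) (c : V → V → ℕ) (l : V → ℕ)
    (u w : V × Fin (2 * n)) : ℕ :=
  if u.2 = w.2 then c u.1 w.1 + layerShift n r u.2
  else if u.1 = w.1 then l u.1 + linkShift n r u.2 w.2 else 0

theorem IsIntervalLabeling.boxCycle [DecidableEq V] {G : SimpleGraph V} {r t n : ℕ}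
    {c : V → V → ℕ} {l : V → ℕ} (h : G.IsIntervalLabeling r t c l) (hn : 1 ≤ n) :
    (G □ cycleGraph (2 * n)).IsIntervalLabeling (r + 2) (t + n * (r + 1) + 1)
      (boxCycleLabel n r c l) (fun u => l u.1 + windowShift n r u.2) where
  symm := by
    rintro ⟨v, x⟩ ⟨w, y⟩
    simp only [boxCycleLabel, h.symm v w, linkShift_comm n r x y]
    grind
  injOn := by
    rintro ⟨v, x⟩ ⟨w, y⟩ hw ⟨u, z⟩ hu hwu
    simp only [mem_neighborSet, boxProd_adj] at hw hu
    rcases hw with ⟨hw, rfl⟩ | ⟨hw, rfl⟩ <;> rcases hu with ⟨hu, rfl⟩ | ⟨hu, rfl⟩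
    · simp only [boxCycleLabel, if_true, add_left_inj] at hwu
      rw [h.injOn v hw hu hwu]
    · have h1 := h.mem_Ico v w hw
      have h2 := linkShift_mem (r := r) hu
      simp only [boxCycleLabel, hu.ne, if_true, if_false, Set.mem_Ico] at hwu h1
      omega
    · have h1 := h.mem_Ico v u hu
      have h2 := linkShift_mem (r := r) hw
      simp only [boxCycleLabel, hw.ne, if_true, if_false, Set.mem_Ico] at hwu h1
      omega
    · simp only [boxCycleLabel, hw.ne, hu.ne, if_true, if_false, add_right_inj] at hwu
      rw [linkShift_injOn x hw hu hwu]
  mem_Ico := by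
    rintro ⟨v, x⟩ ⟨w, y⟩ hw
    rw [boxProd_adj] at hw
    rcases hw with ⟨hw, rfl⟩ | ⟨hw, rfl⟩
    · have h1 := h.mem_Ico v w hw
      have h2 := layerShift_mem n r x
      simp only [boxCycleLabel, if_true, Set.mem_Ico] at h1 ⊢
      omega
    · have h2 := linkShift_mem (r := r) (x := x) (y := y) hw
      simp only [boxCycleLabel, hw.ne, if_true, if_false, Set.mem_Ico]
      omega
  one_le u := (h.one_le u.1).trans (Nat.le_add_right _ _)
  le := by
    rintro ⟨v, x⟩
    have h1 := h.le v
    have hlev : cycleLevel n x ≤ n ∧ (n < x → cycleLevel n x + 1 ≤ n) := by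
      simp only [cycleLevel]
      omega
    have h2 := Nat.mul_le_mul_right (r + 1) hlev.1
    have h3 : 0 < n * (r + 1) := by positivity
    simp only [windowShift]
    by_cases hx : n < x
    · have h4 := Nat.mul_le_mul_right (r + 1) (hlev.2 hx)
      rw [add_mul] at h4
      simp only [hx, if_true]
      omega
    · simp only [hx, if_false]
      omega
  exists_min := by
    obtain ⟨v, hv⟩ := h.exists_min
    exact ⟨(v, ⟨0, by omega⟩), by simp [hv, windowShift, cycleLevel]⟩
  exists_max := by
    obtain ⟨v, hv⟩ := h.exists_max
    have h3 : 0 < n * (r + 1) := by positivity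
    have hlev : cycleLevel n n = n := by
      simp only [cycleLevel]
      omega
    refine ⟨(v, ⟨n, by omega⟩), ?_⟩
    simp only [windowShift, hlev, lt_irrefl, if_false]
    omega

end SimpleGraph

/-- `□` is the Cartesian product of graphs. The bound is stated in `ℤ`. -/
theorem corollary2 (n p q : ℕ) (hn : 2 ≤ n) (hp : Odd p) (hnpq : n = p * 2 ^ q) :
    (SimpleGraph.completeGraph (Fin (2 * n)) □ SimpleGraph.cycleGraph (2 * n)).IntervalColorable ∧
      2 * (n : ℤ) ^ 2 + 4 * (n : ℤ) - 1 - (p : ℤ) - (q : ℤ) ≤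
        ((SimpleGraph.completeGraph (Fin (2 * n)) □
          SimpleGraph.cycleGraph (2 * n)).maxIntervalColors : ℤ) := by
  have hK := SimpleGraph.exists_isIntervalLabeling_complete hp.pos q
  rw [← hnpq] at hK
  obtain ⟨t, c, l, ht, h⟩ := hK
  -- The product has degree `(2 * n - 1) + 2`.
  have hreg : (SimpleGraph.completeGraph (Fin (2 * n)) □
      SimpleGraph.cycleGraph (2 * n)).IsRegularOfDegree (2 * n - 1 + 2) := by
    intro u
    rw [SimpleGraph.degree_boxProd]
    congr 1
    · simp
    · exact SimpleGraph.cycleGraph_degree_eq_two (by omega) u.2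
  have hconn : (SimpleGraph.completeGraph (Fin (2 * n)) □
      SimpleGraph.cycleGraph (2 * n)).Preconnected :=
    SimpleGraph.Preconnected.boxProd SimpleGraph.preconnected_top
      SimpleGraph.cycleGraph_preconnected
  have hmem : t + n * (2 * n - 1 + 1) + 1 ∈ (SimpleGraph.completeGraph (Fin (2 * n)) □
      SimpleGraph.cycleGraph (2 * n)).intervalSpectrum :=
    ⟨Nat.succ_pos _, _, (h.boxCycle (by omega)).isIntervalColoring hreg (by omega) hconn⟩
  have hcol : (SimpleGraph.completeGraph (Fin (2 * n)) □
      SimpleGraph.cycleGraph (2 * n)).IntervalColorable := ⟨_, hmem⟩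
  refine ⟨hcol, ?_⟩
  have hle := (SimpleGraph.isGreatest_maxIntervalColors _ hcol).2 hmem
  rw [Nat.sub_add_cancel (by omega)] at hle
  zify at hle ht
  linarith
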